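/- For a nonempty compact set $K\subset\mathbb{R}$ and $p\neq 0$, define the Riesz $p$-energy $V_p(K)\in[0,\infty]$ as the minimum (if $p>0$), respectively the maximum (if $p<0$), of $$\int_K\int_K |x-y|^{-p}\,d\mu(x)\,d\mu(y)$$ over all Borel probability measures $\mu$ on $K$, and let $V_{\log}(K)\in(-\infty,\infty]$ be the minimum of $\int_K\int_K \log\frac{1}{|x-y|}\,d\mu(x)\,d\mu(y)$ over the same measures. On the diagonal $x=y$ the kernel $|x-y|^{-p}$ equals $+\infty$ if $p>0$ and $0$ if $p<0$, and the logarithmic kernel equals $+\infty$. Put $V_p(\emptyset)=+\infty$ for $p>0$, $V_p(\emptyset)=0$ for $p<0$, and $V_{\log}(\emptyset)=+\infty$. The Riesz $p$-capacity of a compact set $K$ is $$\mathrm{Cap}_p(K)=\begin{cases} V_p(K)^{-1/p}, & p\neq 0,\\ \exp(-V_{\log}(K)), & p=0,\end{cases}$$ with the conventions $(+\infty)^{-1/p}=0$ for $p>0$ and $\exp(-\infty)=0$. A set $Z\subset\mathbb{R}$ has inner $p$-capacity zero if $\mathrm{Cap}_p(Z')=0$ for every compact $Z'\subset Z$. $\mathrm{Length}$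 denotes Lebesgue measure on $\mathbb{R}$. **Theorem.** Let $p<1$ be real and let $K\subset\mathbb{R}$ be compact. Then $$\mathrm{Cap}_p(K)\ \ge\ \frac{\mathrm{Cap}_p([-1,1])}{2}\,\mathrm{Length}(K). \qquad (*)$$ When $K$ has positive length, equality holds in $(*)$ if and only if $K=J\cup Z$ for some nondegenerate closed interval $J=[a,b]$, $a<b$, and some set $Z$ such that $Z$ has inner $p$-capacity zero if $0\le p<1$, and $Z$ is empty if $p<0$. When $K$ has zero length, equality holds in $(*)$ if and only if $\mathrm{Cap}_p(K)=0$, which when $p<0$ means that $K$ is either empty or a singleton. -/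

import Mathlib

open MeasureTheory Set
open scoped ENNReal

/-- `μ` is a Borel probability measure on `K`: total mass one, no mass outside `K`. -/
def IsProbOn (K : Set ℝ) (μ : Measure ℝ) : Prop :=
  IsProbabilityMeasure μ ∧ μ Kᶜ = 0

/-- The energy `∫∫ |x - y| ^ (-p) dμ dμ` of a measure, for `p ≠ 0`, valued in `[0, ∞]`.
On the diagonal the kernel is `∞` if `p > 0` and `0` if `p < 0`. -/
noncomputable def rieszEnergyOf (p : ℝ) (μ : Measure ℝ) : ℝ≥0∞ :=
  ∫⁻ x, ∫⁻ y, edist x y ^ (-p) ∂μ ∂μ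

/-- The energy `∫∫ log (1 / |x - y|) dμ dμ` of a measure, as the integral of the positive part of
the kernel minus the integral of its negative part. The kernel is `+∞` on the diagonal. On a
probability measure with bounded support the negative part has finite integral, so that the
difference is a well-defined element of `(-∞, ∞]`. -/
noncomputable def logEnergyOf (μ : Measure ℝ) : EReal :=
  ((∫⁻ x, ∫⁻ y, (-ENNReal.log (edist x y)).toENNReal ∂μ ∂μ : ℝ≥0∞) : EReal)
    - ((∫⁻ x, ∫⁻ y, (ENNReal.log (edist x y)).toENNReal ∂μ ∂μ : ℝ≥0∞) : EReal)

/-- The Riesz `p`-energy `V_p(K)`, for `p ≠ 0`: the least energy of a probability measure on `K`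
if `p > 0`, the greatest one if `p < 0`. For `K = ∅` it is `∞` if `p > 0` and `0` if `p < 0`. -/
noncomputable def rieszEnergy (p : ℝ) (K : Set ℝ) : ℝ≥0∞ :=
  if 0 < p then ⨅ (μ : Measure ℝ) (_ : IsProbOn K μ), rieszEnergyOf p μ
  else ⨆ (μ : Measure ℝ) (_ : IsProbOn K μ), rieszEnergyOf p μ

/-- The logarithmic energy of `K`, which is `∞` for `K = ∅`. -/
noncomputable def logEnergy (K : Set ℝ) : EReal :=
  ⨅ (μ : Measure ℝ) (_ : IsProbOn K μ), logEnergyOf μ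

/-- The Riesz `p`-capacity of a compact set `K ⊆ ℝ`: `V_p(K) ^ (-1/p)` if `p ≠ 0` (with
`∞ ^ (-1/p) = 0` if `p > 0`), and `exp (-V_log(K))` if `p = 0` (with `exp (-∞) = 0`). -/
noncomputable def rieszCap (p : ℝ) (K : Set ℝ) : ℝ≥0∞ :=
  if p = 0 then EReal.exp (-logEnergy K) else rieszEnergy p K ^ (-1 / p)

/-- `Z` has inner `p`-capacity zero: every compact subset of `Z` has `p`-capacity zero. -/
def InnerCapZero (p : ℝ) (Z : Set ℝ) : Prop :=
  ∀ Z' : Set ℝ, IsCompact Z' → Z' ⊆ Z → rieszCap p Z' = 0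

/-! The map `T x = |K ∩ (-∞, x]|` is 1-Lipschitz and sends `K` onto `[0, |K|]`. A section of `T`
expands distances, so it carries each probability measure on the interval to one on `K` of no
greater energy, for any nonincreasing kernel (`IsEnergyKernel.kernelEnergy_le_kernelEnergy_Icc`).
For every `p < 1`, the capacity of sets of diameter at most `D` is a strictly decreasing function of
the least energy for such a kernel: `r ^ (-p)`, `log (D / r)` or `D ^ (-p) - r ^ (-p)` according to
the sign of `p` (`exists_energyKernel_rieszCap`). Scaling supplies the constant.

For equality (`IsEnergyKernel.exists_Icc_of_kernelEnergy_eq`), the section carries a minimiser on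
the interval to a minimiser `ν` on `K`. Equal energies force `T` to be isometric on the support of
`ν`; at its extreme points `a ≤ b` this says that `K` fills `[a, b]`. A point of `K` outside `[a,
b]` is farther from the whole support than the nearer endpoint is, so the potential of `ν` is
smaller there than at that endpoint, hence below the minimal energy. By the variational inequality,
measures of finite energy do not charge such points (`measure_kernelPotential_lt_eq_zero`). This
means inner capacity zero if `p ≥ 0`, and emptiness if `p < 0`, where point masses have finite
energy. Conversely, a set of inner capacity zero affects neither length nor energy. -/

open Filter Topology

/-! ### Energies for a general kernel -/

/-- The energy `∫∫ k(|x - y|) dμ dμ` of a measure for the kernel `k`. -/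
noncomputable def kernelEnergyOf (k : ℝ≥0∞ → ℝ≥0∞) (μ : Measure ℝ) : ℝ≥0∞ :=
  ∫⁻ x, ∫⁻ y, k (edist x y) ∂μ ∂μ

/-- The least energy of a probability measure on `K` for the kernel `k`. -/
noncomputable def kernelEnergy (k : ℝ≥0∞ → ℝ≥0∞) (K : Set ℝ) : ℝ≥0∞ :=
  ⨅ (μ : Measure ℝ) (_ : IsProbOn K μ), kernelEnergyOf k μ

/-- The potential of a measure for the kernel `k`. -/
noncomputable def kernelPotential (k : ℝ≥0∞ → ℝ≥0∞) (μ : Measure ℝ) (x : ℝ) : ℝ≥0∞ :=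
  ∫⁻ y, k (edist x y) ∂μ

section Kernel

variable {k : ℝ≥0∞ → ℝ≥0∞}

lemma kernelEnergy_le {K : Set ℝ} {μ : Measure ℝ} (hμ : IsProbOn K μ) :
    kernelEnergy k K ≤ kernelEnergyOf k μ :=
  iInf₂_le μ hμ

lemma kernelEnergy_anti {K K' : Set ℝ} (h : K ⊆ K') : kernelEnergy k K' ≤ kernelEnergy k K :=
  le_iInf₂ fun _ hμ => kernelEnergy_le ⟨hμ.1, measure_mono_null (compl_subset_compl.2 h) hμ.2⟩

lemma measurable_kernel (hk : Continuous k) :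
    Measurable fun z : ℝ × ℝ => k (edist z.1 z.2) :=
  hk.measurable.comp (measurable_fst.edist measurable_snd)

lemma measurable_kernel_left (hk : Continuous k) (x : ℝ) :
    Measurable fun y : ℝ => k (edist x y) :=
  hk.measurable.comp (measurable_const.edist measurable_id)

lemma measurable_kernelPotential (hk : Continuous k) (μ : Measure ℝ) [SFinite μ] :
    Measurable (kernelPotential k μ) :=
  (measurable_kernel hk).lintegral_prod_right'

lemma kernelEnergyOf_eq_lintegral_potential (μ : Measure ℝ) :
    kernelEnergyOf k μ = ∫⁻ x, kernelPotential k μ x ∂μ := rfl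

lemma kernelEnergyOf_eq_lintegral_prod (hk : Continuous k) (μ : Measure ℝ) [SFinite μ] :
    kernelEnergyOf k μ = ∫⁻ z, k (edist z.1 z.2) ∂(μ.prod μ) :=
  (lintegral_prod _ (measurable_kernel hk).aemeasurable).symm

lemma lintegral_kernelPotential_comm (hk : Continuous k) (μ ν : Measure ℝ) [SFinite μ]
    [SFinite ν] : ∫⁻ x, kernelPotential k μ x ∂ν = ∫⁻ x, kernelPotential k ν x ∂μ := by
  unfold kernelPotential
  rw [lintegral_lintegral_swap (measurable_kernel hk).aemeasurable]
  simp_rw [edist_comm]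

/-- Truncating the kernel at `n` makes it bounded and continuous, so the energy is a supremum of
weakly continuous functionals. -/
lemma lowerSemicontinuous_kernelEnergyOf (hk : Continuous k) :
    LowerSemicontinuous fun μ : ProbabilityMeasure ℝ => kernelEnergyOf k (μ : Measure ℝ) := by
  have hmono : Monotone fun (n : ℕ) (z : ℝ × ℝ) => min (k (edist z.1 z.2)) (n : ℝ≥0∞) :=
    fun m n hmn z => min_le_min le_rfl (by exact_mod_cast hmn)
  have key : ∀ μ : ProbabilityMeasure ℝ, kernelEnergyOf k (μ : Measure ℝ)
      = ⨆ n : ℕ, ∫⁻ z, min (k (edist z.1 z.2)) (n : ℝ≥0∞) ∂(μ.prod μ : Measure (ℝ × ℝ)) := by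
    intro μ
    rw [kernelEnergyOf_eq_lintegral_prod hk,
      ← lintegral_iSup (fun n => (measurable_kernel hk).min measurable_const) hmono]
    refine lintegral_congr fun z => ?_
    rw [← inf_iSup_eq, ENNReal.iSup_natCast, inf_top_eq]
  simp_rw [key]
  refine lowerSemicontinuous_iSup fun n => Continuous.lowerSemicontinuous ?_
  have hne : ∀ z : ℝ × ℝ, min (k (edist z.1 z.2)) (n : ℝ≥0∞) ≠ ∞ :=
    fun z => ne_top_of_le_ne_top (ENNReal.natCast_ne_top n) (min_le_right _ _)
  have hcont : Continuous fun z : ℝ × ℝ => (min (k (edist z.1 z.2)) (n : ℝ≥0∞)).toNNReal :=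
    ENNReal.continuousOn_toNNReal.comp_continuous
      ((hk.comp (continuous_fst.edist continuous_snd)).min continuous_const) hne
  have hbound : ∀ z : ℝ × ℝ, (min (k (edist z.1 z.2)) (n : ℝ≥0∞)).toNNReal ≤ n := by
    intro z
    rw [← ENNReal.coe_le_coe, ENNReal.coe_toNNReal (hne z)]
    exact_mod_cast min_le_right _ _
  let f : BoundedContinuousFunction (ℝ × ℝ) NNReal :=
    BoundedContinuousFunction.mkOfBound ⟨_, hcont⟩ n fun x y => by
      rw [NNReal.dist_eq, abs_le]
      have hx : (((min (k (edist x.1 x.2)) (n : ℝ≥0∞)).toNNReal : NNReal) : ℝ) ≤ n := by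
        exact_mod_cast hbound x
      have hy : (((min (k (edist y.1 y.2)) (n : ℝ≥0∞)).toNNReal : NNReal) : ℝ) ≤ n := by
        exact_mod_cast hbound y
      have hx0 := NNReal.coe_nonneg (min (k (edist x.1 x.2)) (n : ℝ≥0∞)).toNNReal
      have hy0 := NNReal.coe_nonneg (min (k (edist y.1 y.2)) (n : ℝ≥0∞)).toNNReal
      constructor <;> simp only [ContinuousMap.coe_mk] <;> linarith
  have hf : ∀ z, (f z : ℝ≥0∞) = min (k (edist z.1 z.2)) (n : ℝ≥0∞) :=
    fun z => ENNReal.coe_toNNReal (hne z)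
  simp_rw [← hf]
  have hprod : Continuous fun μ : ProbabilityMeasure ℝ => μ.prod μ := by fun_prop
  refine continuous_iff_continuousAt.2 fun μ => ?_
  exact ProbabilityMeasure.tendsto_iff_forall_lintegral_tendsto.1 hprod.continuousAt f

lemma isProbOn_dirac {K : Set ℝ} {x : ℝ} (hx : x ∈ K) : IsProbOn K (Measure.dirac x) := by
  refine ⟨inferInstance, ?_⟩
  have : Kᶜ ⊆ {x}ᶜ := by simpa using hx
  refine measure_mono_null this ?_
  rw [Measure.dirac_apply' _ (measurableSet_singleton x).compl]
  simp

lemma exists_kernelEnergyOf_eq_kernelEnergy (hk : Continuous k) {K : Set ℝ} (hK : IsCompact K)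
    (hne : K.Nonempty) : ∃ μ, IsProbOn K μ ∧ kernelEnergyOf k μ = kernelEnergy k K := by
  -- Weak compactness by tightness, with the constant sequences `K` of compact sets and `0` of mass
  -- bounds.
  have hcomp : IsCompact {μ : ProbabilityMeasure ℝ | ∀ _ : ℕ, μ Kᶜ ≤ 0} :=
    isCompact_setOfPred_probabilityMeasure_mass_eq_compl_isCompact_le
      (u := fun _ => 0) (K := fun _ => K) tendsto_const_nhds (fun _ => hK)
      (Or.inr monotone_const)
  have hmem : ∀ μ : ProbabilityMeasure ℝ,
      μ ∈ {μ : ProbabilityMeasure ℝ | ∀ _ : ℕ, μ Kᶜ ≤ 0} ↔ IsProbOn K (μ : Measure ℝ) := by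
    intro μ
    simp only [mem_ofPred_eq, nonpos_iff_eq_zero, forall_const]
    rw [ProbabilityMeasure.null_iff_toMeasure_null]
    exact ⟨fun h => ⟨inferInstance, h⟩, fun h => h.2⟩
  obtain ⟨x, hx⟩ := hne
  let δ : ProbabilityMeasure ℝ := ⟨Measure.dirac x, inferInstance⟩
  obtain ⟨μ, hμ, hmin⟩ := LowerSemicontinuousOn.exists_isMinOn
    ⟨δ, (hmem δ).2 (isProbOn_dirac hx)⟩ hcomp ((lowerSemicontinuous_kernelEnergyOf hk).lowerSemicontinuousOn _)
  refine ⟨μ, (hmem μ).1 hμ, le_antisymm (le_iInf₂ fun ν hν => ?_) (kernelEnergy_le ((hmem μ).1 hμ))⟩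
  exact hmin ((hmem ⟨ν, hν.1⟩).2 hν)

/-! ### Variational inequalities for energy minimisers -/

lemma kernelEnergyOf_smul_add_smul (hk : Continuous k) (μ ν : Measure ℝ) [SFinite μ] [SFinite ν]
    (a b : NNReal) :
    kernelEnergyOf k (a • μ + b • ν) = a ^ 2 * kernelEnergyOf k μ
      + 2 * (a * b * ∫⁻ x, kernelPotential k μ x ∂ν) + b ^ 2 * kernelEnergyOf k ν := by
  have hpot : ∀ x, kernelPotential k (a • μ + b • ν) x
      = a * kernelPotential k μ x + b * kernelPotential k ν x := by
    intro x
    simp only [kernelPotential, lintegral_add_measure, lintegral_smul_measure]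
    rfl
  have hμ := measurable_kernelPotential hk μ
  have hν := measurable_kernelPotential hk ν
  have hint : ∀ ρ : Measure ℝ, ∫⁻ x, (a * kernelPotential k μ x + b * kernelPotential k ν x) ∂ρ
      = a * ∫⁻ x, kernelPotential k μ x ∂ρ + b * ∫⁻ x, kernelPotential k ν x ∂ρ := by
    intro ρ
    rw [lintegral_add_left (hμ.const_mul _), lintegral_const_mul _ hμ, lintegral_const_mul _ hν]
  simp only [kernelEnergyOf_eq_lintegral_potential, hpot]
  rw [lintegral_add_measure, lintegral_smul_measure, lintegral_smul_measure, hint, hint,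
    lintegral_kernelPotential_comm hk ν μ]
  simp only [ENNReal.smul_def, smul_eq_mul]
  ring

/-- The variational inequality for an energy minimiser. -/
lemma kernelEnergy_le_lintegral_kernelPotential (hk : Continuous k) {K : Set ℝ}
    {μ ν : Measure ℝ} (hμ : IsProbOn K μ) (hmin : kernelEnergyOf k μ = kernelEnergy k K)
    (hfin : kernelEnergy k K ≠ ∞) (hν : IsProbOn K ν) (hνfin : kernelEnergyOf k ν ≠ ∞) :
    kernelEnergy k K ≤ ∫⁻ x, kernelPotential k μ x ∂ν := by
  have := hμ.1
  have := hν.1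
  by_contra! hlt
  set M := ∫⁻ x, kernelPotential k μ x ∂ν with hM
  have hMfin : M ≠ ∞ := hlt.ne_top
  set v := (kernelEnergy k K).toReal
  set m := M.toReal
  set s := (kernelEnergyOf k ν).toReal
  have hmv : m < v := (ENNReal.toReal_lt_toReal hMfin hfin).2 hlt
  have key : ∀ t : NNReal, t ≤ 1 → v ≤ (1 - t) ^ 2 * v + 2 * ((1 - t) * t * m) + t ^ 2 * s := by
    intro t ht
    have hprob : IsProbOn K ((1 - t) • μ + t • ν) := by
      refine ⟨⟨?_⟩, ?_⟩
      · simp only [Measure.coe_add, Measure.coe_nnreal_smul_apply, Pi.add_apply, measure_univ,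
          mul_one]
        exact_mod_cast tsub_add_cancel_of_le ht
      · simp [hμ.2, hν.2]
    have h := kernelEnergy_le (k := k) hprob
    rw [kernelEnergyOf_smul_add_smul hk, hmin, ← hM] at h
    have hne : ((1 - t : NNReal) : ℝ≥0∞) ^ 2 * kernelEnergy k K
      + 2 * (((1 - t : NNReal) : ℝ≥0∞) * t * M) + (t : ℝ≥0∞) ^ 2 * kernelEnergyOf k ν ≠ ∞ := by
      finiteness
    have h' := (ENNReal.toReal_le_toReal hfin hne).2 h
    rw [ENNReal.toReal_add (by finiteness) (by finiteness),
      ENNReal.toReal_add (by finiteness) (by finiteness)] at h'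
    simpa only [ENNReal.toReal_mul, ENNReal.toReal_pow, ENNReal.coe_toReal, NNReal.coe_sub ht,
      NNReal.coe_one, ENNReal.toReal_ofNat] using h'
  -- `key` amounts to `2 * (v - m) ≤ t * (v - 2 * m + s)` for `0 < t ≤ 1`. The `t` below satisfies
  -- `t * q ≤ v - m`, which contradicts this.
  set q := |v - 2 * m + s| with hq
  have hq0 : 0 ≤ q := abs_nonneg _
  have hden : 0 < q + (v - m) := by linarith
  have ht0 : 0 < (v - m) / (q + (v - m)) := div_pos (by linarith) hden
  have ht1 : (v - m) / (q + (v - m)) ≤ 1 := (div_le_one hden).2 (by linarith)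
  set t := (v - m) / (q + (v - m))
  have h : v ≤ (1 - t) ^ 2 * v + 2 * ((1 - t) * t * m) + t ^ 2 * s :=
    key ⟨t, ht0.le⟩ (by exact_mod_cast ht1)
  have htq : t * (q + (v - m)) = v - m := div_mul_cancel₀ _ hden.ne'
  have h1 : t * (2 * (v - m)) ≤ t * (t * (v - 2 * m + s)) := by nlinarith
  have h2 := le_of_mul_le_mul_left h1 ht0
  have h3 : t * (v - 2 * m + s) ≤ t * q := mul_le_mul_of_nonneg_left (le_abs_self _) ht0.le
  nlinarith

lemma isProbOn_cond {K A : Set ℝ} {σ : Measure ℝ} (hσ : IsProbOn K σ) (hA : σ A ≠ 0) :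
    IsProbOn K (ProbabilityTheory.cond σ A) := by
  have := hσ.1
  exact ⟨ProbabilityTheory.cond_isProbabilityMeasure hA,
    ProbabilityTheory.cond_absolutelyContinuous hσ.2⟩

lemma kernelEnergyOf_cond_ne_top {A : Set ℝ} {σ : Measure ℝ} (hA : σ A ≠ 0)
    (hfin : kernelEnergyOf k σ ≠ ∞) : kernelEnergyOf k (ProbabilityTheory.cond σ A) ≠ ∞ := by
  have hle : ∀ f : ℝ → ℝ≥0∞, ∫⁻ x, f x ∂(ProbabilityTheory.cond σ A) ≤ (σ A)⁻¹ * ∫⁻ x, f x ∂σ := by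
    intro f
    rw [ProbabilityTheory.cond, lintegral_smul_measure, smul_eq_mul]
    gcongr
    exact Measure.restrict_le_self
  have hinv : (σ A)⁻¹ ≠ ∞ := ENNReal.inv_ne_top.2 hA
  refine ne_top_of_le_ne_top (b := (σ A)⁻¹ * ((σ A)⁻¹ * kernelEnergyOf k σ)) (by finiteness) ?_
  refine (hle _).trans ?_
  gcongr
  refine (lintegral_mono fun x => hle _).trans ?_
  rw [lintegral_const_mul' _ _ hinv]
  rfl

/-- A measure of finite energy does not charge the set where the equilibrium potential is less
than the equilibrium energy. -/
lemma measure_kernelPotential_lt_eq_zero (hk : Continuous k) {K : Set ℝ}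
    {μ σ : Measure ℝ} (hμ : IsProbOn K μ) (hmin : kernelEnergyOf k μ = kernelEnergy k K)
    (hfin : kernelEnergy k K ≠ ∞) (hσ : IsProbOn K σ) (hσfin : kernelEnergyOf k σ ≠ ∞) :
    σ {x | kernelPotential k μ x < kernelEnergy k K} = 0 := by
  have := hμ.1
  have := hσ.1
  by_contra hA
  set A := {x | kernelPotential k μ x < kernelEnergy k K}
  have hAm : MeasurableSet A := measurableSet_lt (measurable_kernelPotential hk μ) measurable_const
  -- Conditioned on `A`, `σ` is still a competitor of finite energy, but the mean of the potential
  -- over it is less than the minimal energy.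
  have hprob := isProbOn_cond hσ hA
  have := hprob.1
  have h1 := kernelEnergy_le_lintegral_kernelPotential hk hμ hmin hfin hprob
    (kernelEnergyOf_cond_ne_top hA hσfin)
  have hae : ∀ᵐ x ∂(ProbabilityTheory.cond σ A), kernelPotential k μ x < kernelEnergy k K :=
    ProbabilityTheory.ae_cond_mem hAm
  have hle : ∫⁻ x, kernelPotential k μ x ∂(ProbabilityTheory.cond σ A) ≤ kernelEnergy k K := by
    refine (lintegral_mono_ae (hae.mono fun _ h => h.le)).trans ?_
    simp
  have hlt := lintegral_strict_mono (μ := ProbabilityTheory.cond σ A)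
    (IsProbabilityMeasure.ne_zero _) aemeasurable_const (ne_top_of_le_ne_top hfin hle) hae
  simp only [lintegral_const, measure_univ, mul_one] at hlt
  exact absurd h1 (not_le.2 hlt)

/-- The potential is almost everywhere at least the minimal energy, and its mean over `μ` is exactly
that energy. -/
lemma kernelPotential_ae_eq (hk : Continuous k) {K : Set ℝ}
    {μ : Measure ℝ} (hμ : IsProbOn K μ) (hmin : kernelEnergyOf k μ = kernelEnergy k K)
    (hfin : kernelEnergy k K ≠ ∞) : ∀ᵐ x ∂μ, kernelPotential k μ x = kernelEnergy k K := by
  have := hμ.1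
  have h0 := measure_kernelPotential_lt_eq_zero hk hμ hmin hfin hμ (hmin ▸ hfin)
  have hge : ∀ᵐ x ∂μ, kernelEnergy k K ≤ kernelPotential k μ x := by
    rw [ae_iff]; simpa using h0
  have := ae_eq_of_ae_le_of_lintegral_le hge (by simpa using hfin)
    (measurable_kernelPotential hk μ).aemeasurable
    (by rw [← kernelEnergyOf_eq_lintegral_potential, hmin]; simp)
  filter_upwards [this] with x hx using hx.symm

lemma lowerSemicontinuous_kernelPotential (hk : Continuous k) (μ : Measure ℝ) :
    LowerSemicontinuous (kernelPotential k μ) := by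
  refine lowerSemicontinuous_iff_isClosed_preimage.2 fun c => ?_
  refine isSeqClosed_iff_isClosed.1 fun u x hu hx => ?_
  have hcont : ∀ y, Tendsto (fun n => k (edist (u n) y)) atTop (𝓝 (k (edist x y))) := fun y =>
    ((hk.comp (continuous_id.edist continuous_const)).tendsto x).comp hx
  calc kernelPotential k μ x = ∫⁻ y, liminf (fun n => k (edist (u n) y)) atTop ∂μ :=
        lintegral_congr fun y => (hcont y).liminf_eq.symm
    _ ≤ liminf (fun n => ∫⁻ y, k (edist (u n) y) ∂μ) atTop :=
        lintegral_liminf_le fun n => measurable_kernel_left hk _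
    _ ≤ c := liminf_le_of_frequently_le' (Frequently.of_forall hu)

/-- By lower semicontinuity the almost everywhere bound holds on a closed set, hence at every point
of the support, in particular at its endpoints. -/
lemma kernelPotential_le_of_mem_support (hk : Continuous k) {K : Set ℝ}
    {μ : Measure ℝ} (hμ : IsProbOn K μ) (hmin : kernelEnergyOf k μ = kernelEnergy k K)
    (hfin : kernelEnergy k K ≠ ∞) {x : ℝ} (hx : x ∈ μ.support) :
    kernelPotential k μ x ≤ kernelEnergy k K := by
  have hclosed : IsClosed {x | kernelPotential k μ x ≤ kernelEnergy k K} :=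
    lowerSemicontinuous_iff_isClosed_preimage.1 (lowerSemicontinuous_kernelPotential hk μ) _
  have hae : {x | kernelPotential k μ x ≤ kernelEnergy k K} ∈ ae μ :=
    (kernelPotential_ae_eq hk hμ hmin hfin).mono fun x hx => hx.le
  exact Measure.support_subset_of_isClosed hclosed hae hx

end Kernel

/-! ### Collapsing a compact set onto an interval -/

/-- The map `x ↦ |K ∩ (-∞, x]|` is a `1`-Lipschitz map of `K` onto `[0, |K|]`, with a measurable
section. -/
lemma exists_collapse {K : Set ℝ} (hK : IsCompact K) (hne : K.Nonempty) :
    ∃ T s : ℝ → ℝ, LipschitzWith 1 T ∧ Measurable s ∧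
      (∀ t ∈ Icc 0 (volume.real K), s t ∈ K ∧ T (s t) = t) ∧
      ∀ x y, x ≤ y → T y - T x = volume.real (K ∩ Ioc x y) := by
  set T : ℝ → ℝ := fun x => volume.real (K ∩ Iic x) with hT
  have hfin : ∀ A : Set ℝ, volume (K ∩ A) ≠ ∞ := fun A =>
    ne_top_of_le_ne_top hK.measure_lt_top.ne (measure_mono inter_subset_left)
  have hdiff : ∀ x y, x ≤ y → T y - T x = volume.real (K ∩ Ioc x y) := by
    intro x y hxy
    have hunion : K ∩ Iic y = (K ∩ Iic x) ∪ (K ∩ Ioc x y) := by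
      rw [← inter_union_distrib_left, Iic_union_Ioc_eq_Iic hxy]
    have hdisj : Disjoint (K ∩ Iic x) (K ∩ Ioc x y) :=
      (Iic_disjoint_Ioc le_rfl).mono inter_subset_right inter_subset_right
    simp only [hT]
    rw [hunion, measureReal_union hdisj (hK.measurableSet.inter measurableSet_Ioc) (hfin _)
      (hfin _)]
    ring
  have hmono : Monotone T := fun x y hxy => by
    have := hdiff x y hxy
    have : 0 ≤ volume.real (K ∩ Ioc x y) := measureReal_nonneg
    linarith
  have hlip : LipschitzWith 1 T := by
    refine LipschitzWith.of_le_add fun x y => ?_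
    rcases le_total x y with h | h
    · exact (hmono h).trans (by simp)
    · have h1 := hdiff y x h
      have h2 : volume.real (K ∩ Ioc y x) ≤ volume.real (Ioc y x) :=
        measureReal_mono inter_subset_right (by simp)
      rw [Real.volume_real_Ioc_of_le h] at h2
      rw [Real.dist_eq, abs_of_nonneg (by linarith)]
      linarith
  have hmin := hK.sInf_mem hne
  have hmax := hK.sSup_mem hne
  have hTmin : T (sInf K) = 0 := by
    have : K ∩ Iic (sInf K) ⊆ {sInf K} := fun x hx => le_antisymm hx.2 (csInf_le hK.bddBelow hx.1)
    simp [hT, measureReal_def, measure_mono_null this (measure_singleton _)]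
  have hTmax : T (sSup K) = volume.real K := by
    simp only [hT]
    rw [(inter_eq_left (s := K) (t := Iic (sSup K))).2 fun x hx =>
      mem_Iic.2 (le_csSup hK.bddAbove hx)]
  have hsurj : ∀ t ∈ Icc 0 (volume.real K), ∃ x ∈ K, T x = t := by
    intro t ht
    have hle : sInf K ≤ sSup K := csInf_le hK.bddBelow hmax
    have ht' : t ∈ Icc (T (sInf K)) (T (sSup K)) := by rwa [hTmin, hTmax]
    obtain ⟨x, hx, rfl⟩ := intermediate_value_Icc hle hlip.continuous.continuousOn ht'
    -- The preimage `x` may lie off `K`; moving down to the last point of `K` before it leaves `T`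
    -- unchanged.
    have hKx : IsCompact (K ∩ Iic x) := hK.inter_right isClosed_Iic
    have hyK := hKx.sSup_mem ⟨_, hmin, hx.1⟩
    refine ⟨_, hyK.1, ?_⟩
    have : K ∩ Iic (sSup (K ∩ Iic x)) = K ∩ Iic x :=
      Subset.antisymm (fun z hz => ⟨hz.1, mem_Iic.2 (le_trans (mem_Iic.1 hz.2) (mem_Iic.1 hyK.2))⟩)
        fun z hz => ⟨hz.1, mem_Iic.2 (le_csSup hKx.bddAbove hz)⟩
    simp only [hT, this]
  choose! s hs using hsurj
  have h0 : (0 : ℝ) ≤ volume.real K := measureReal_nonneg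
  have hp : ∀ t : ℝ, (projIcc 0 (volume.real K) h0 t : ℝ) ∈ Icc 0 (volume.real K) :=
    fun t => Subtype.prop _
  refine ⟨T, fun t => s (projIcc 0 (volume.real K) h0 t), hlip, ?_, ?_, hdiff⟩
  -- A section of a monotone map is monotone, whatever choices were made.
  · refine Monotone.measurable fun t u htu => ?_
    have hle := monotone_projIcc h0 htu
    rcases hle.eq_or_lt with heq | hlt
    · simp only [heq, le_refl]
    · by_contra! hcon
      have := hmono hcon.le
      rw [(hs _ (hp t)).2, (hs _ (hp u)).2] at this
      exact absurd hlt (not_lt.2 this)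
  · intro t ht
    simp only [projIcc_of_mem h0 ht]
    exact hs t ht

/-- Otherwise `(a, b)` has a product neighbourhood missing `C`, and its measure is a product of two
positive masses. -/
lemma mem_of_ae_of_mem_support {μ : Measure ℝ} [SFinite μ] {C : Set (ℝ × ℝ)} (hC : IsClosed C)
    (hae : ∀ᵐ z ∂(μ.prod μ), z ∈ C) {a b : ℝ} (ha : a ∈ μ.support) (hb : b ∈ μ.support) :
    (a, b) ∈ C := by
  by_contra hab
  obtain ⟨u, v, hu, hv, hau, hbv, huv⟩ := isOpen_prod_iff.1 hC.isOpen_compl a b hab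
  have h0 : (μ.prod μ) (u ×ˢ v) = 0 := measure_mono_null huv hae
  rw [Measure.prod_prod, mul_eq_zero] at h0
  have hu' := (Measure.mem_support_iff_forall a).1 ha u (hu.mem_nhds hau)
  have hv' := (Measure.mem_support_iff_forall b).1 hb v (hv.mem_nhds hbv)
  rcases h0 with h | h
  · exact hu'.ne' h
  · exact hv'.ne' h

/-- A closed set of full measure in a compact interval contains it. -/
lemma Icc_subset_of_volume_real_inter_Ioc {K : Set ℝ} (hK : IsCompact K) {a b : ℝ} (ha : a ∈ K)
    (h : b - a = volume.real (K ∩ Ioc a b)) : Icc a b ⊆ K := by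
  intro x hx
  rcases hx.1.eq_or_lt with rfl | hax
  · exact ha
  by_contra hxK
  have hfin : volume (Ioc a b ∩ K) ≠ ∞ :=
    ne_top_of_le_ne_top hK.measure_lt_top.ne (measure_mono inter_subset_right)
  have hle : a ≤ b := hx.1.trans hx.2
  have hnull : volume (Ioc a b \ K) = 0 := by
    have h1 := measureReal_inter_add_sdiff (μ := volume) (s := Ioc a b) hK.measurableSet
      measure_Ioc_lt_top.ne
    rw [Real.volume_real_Ioc_of_le hle, inter_comm, ← h] at h1
    exact (measureReal_eq_zero_iff (
      ne_top_of_le_ne_top measure_Ioc_lt_top.ne (measure_mono sdiff_subset))).1 (by linarith)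
  -- The gap around `x` is taken to its left, so that it stays in `(a, b]` even if `x = b`.
  obtain ⟨l, hl, hlK⟩ := exists_Ioc_subset_of_mem_nhds (hK.isClosed.isOpen_compl.mem_nhds hxK) ⟨a, hax⟩
  have hsub : Ioc (max l a) x ⊆ Ioc a b \ K := fun y hy =>
    ⟨⟨(le_max_right _ _).trans_lt hy.1, hy.2.trans hx.2⟩, hlK ⟨(le_max_left _ _).trans_lt hy.1, hy.2⟩⟩
  have h0 := measure_mono_null hsub hnull
  rw [Real.volume_Ioc, ENNReal.ofReal_eq_zero] at h0
  have := max_lt hl hax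
  linarith

/-! ### Energy comparison with an interval for monotone kernels -/

/-- A continuous nonincreasing kernel that is strictly decreasing on `[0, R]` and has a locally
integrable singularity. -/
structure IsEnergyKernel (k : ℝ≥0∞ → ℝ≥0∞) (R : ℝ≥0∞) : Prop where
  continuous : Continuous k
  antitone : Antitone k
  strictAntiOn : StrictAntiOn k (Iic R)
  exists_le_rpow : ∃ s : ℝ, 0 ≤ s ∧ s < 1 ∧ ∃ C : ℝ≥0∞, C ≠ ∞ ∧ ∀ r, k r ≤ C * r ^ (-s)

section

variable {k : ℝ≥0∞ → ℝ≥0∞} {R : ℝ≥0∞}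

lemma IsEnergyKernel.kernelPotential_lt (hk : IsEnergyKernel k R) {μ : Measure ℝ} (hμ : μ ≠ 0)
    {x z : ℝ} (hae : ∀ᵐ y ∂μ, edist x y < edist z y ∧ edist z y ≤ R)
    (hfin : kernelPotential k μ x ≠ ∞) : kernelPotential k μ z < kernelPotential k μ x := by
  have hlt : ∀ᵐ y ∂μ, k (edist z y) < k (edist x y) := hae.mono fun y hy =>
    hk.strictAntiOn (hy.1.le.trans hy.2) hy.2 hy.1
  refine lintegral_strict_mono hμ (measurable_kernel_left hk.continuous x).aemeasurable
    (ne_top_of_le_ne_top hfin ?_) hlt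
  exact lintegral_mono_ae (hlt.mono fun y hy => hy.le)

lemma kernelEnergyOf_map (hk : Continuous k) (μ : Measure ℝ) [SFinite μ] {f : ℝ → ℝ}
    (hf : Measurable f) :
    kernelEnergyOf k (μ.map f) = ∫⁻ x, ∫⁻ y, k (edist (f x) (f y)) ∂μ ∂μ := by
  rw [kernelEnergyOf_eq_lintegral_potential,
    lintegral_map (measurable_kernelPotential hk _) hf]
  exact lintegral_congr fun x => lintegral_map (measurable_kernel_left hk _) hf

lemma IsProbOn.ae_mem {K : Set ℝ} {μ : Measure ℝ} (hμ : IsProbOn K μ) : ∀ᵐ x ∂μ, x ∈ K := hμ.2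

lemma IsProbOn.map {K K' : Set ℝ} {μ : Measure ℝ} (hμ : IsProbOn K μ) {f : ℝ → ℝ}
    (hf : Measurable f) (hK' : MeasurableSet K') (hmaps : ∀ x ∈ K, f x ∈ K') :
    IsProbOn K' (μ.map f) := by
  have := hμ.1
  refine ⟨Measure.isProbabilityMeasure_map hf.aemeasurable, ?_⟩
  rw [Measure.map_apply hf hK'.compl]
  exact measure_mono_null (fun x hx hxK => hx (hmaps x hxK)) hμ.2

/-- A section of a 1-Lipschitz map expands distances, and the kernel is nonincreasing. -/
lemma kernelEnergy_le_kernelEnergyOf_map_section (hk : IsEnergyKernel k R) {K : Set ℝ} {L : ℝ}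
    {T s : ℝ → ℝ} (hT : LipschitzWith 1 T) (hs : Measurable s)
    (hsT : ∀ t ∈ Icc 0 L, s t ∈ K ∧ T (s t) = t) {μ : Measure ℝ} (hμ : IsProbOn (Icc 0 L) μ) :
    kernelEnergyOf k (μ.map s) ≤ kernelEnergyOf k μ := by
  have := hμ.1
  rw [kernelEnergyOf_map hk.continuous _ hs]
  refine lintegral_mono_ae (hμ.ae_mem.mono fun x hx => ?_)
  refine lintegral_mono_ae (hμ.ae_mem.mono fun y hy => ?_)
  refine hk.antitone ?_
  have h := hT (s x) (s y)
  rwa [(hsT x hx).2, (hsT y hy).2, ENNReal.coe_one, one_mul] at h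

/-- Among compact sets of given length, an interval has the greatest energy. -/
theorem IsEnergyKernel.kernelEnergy_le_kernelEnergy_Icc (hk : IsEnergyKernel k R) {K : Set ℝ}
    (hK : IsCompact K) (hne : K.Nonempty) :
    kernelEnergy k K ≤ kernelEnergy k (Icc 0 (volume.real K)) := by
  obtain ⟨T, s, hT, hs, hsT, -⟩ := exists_collapse hK hne
  refine le_iInf₂ fun μ hμ => ?_
  exact (kernelEnergy_le (hμ.map hs hK.measurableSet fun t ht => (hsT t ht).1)).trans
    (kernelEnergy_le_kernelEnergyOf_map_section hk hT hs hsT hμ)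

/-- If a compact set has the energy of the interval of the same length, then it is the union of an
interval and of a set that is not charged by measures of finite energy. -/
theorem IsEnergyKernel.exists_Icc_of_kernelEnergy_eq (hk : IsEnergyKernel k R) {K : Set ℝ}
    (hK : IsCompact K) (hne : K.Nonempty) (hR : ∀ x ∈ K, ∀ y ∈ K, edist x y ≤ R)
    (hfin : kernelEnergy k K ≠ ∞)
    (heq : kernelEnergy k K = kernelEnergy k (Icc 0 (volume.real K))) :
    ∃ a b, a ≤ b ∧ Icc a b ⊆ K ∧
      ∀ σ, IsProbOn K σ → kernelEnergyOf k σ ≠ ∞ → σ (K \ Icc a b) = 0 := by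
  obtain ⟨T, s, hT, hs, hsT, hdiff⟩ := exists_collapse hK hne
  obtain ⟨μ, hμ, hμmin⟩ := exists_kernelEnergyOf_eq_kernelEnergy hk.continuous
    (isCompact_Icc (a := 0) (b := volume.real K)) ⟨0, le_rfl, measureReal_nonneg⟩
  have := hμ.1
  set ν := μ.map s with hνdef
  have hν : IsProbOn K ν := hμ.map hs hK.measurableSet fun t ht => (hsT t ht).1
  have := hν.1
  have hνmin : kernelEnergyOf k ν = kernelEnergy k K := by
    refine le_antisymm ?_ (kernelEnergy_le hν)
    rw [heq, ← hμmin]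
    exact kernelEnergy_le_kernelEnergyOf_map_section hk hT hs hsT hμ
  have hTm : Measurable T := hT.continuous.measurable
  have hmapT : ν.map T = μ := by
    rw [hνdef, Measure.map_map hTm hs]
    have : T ∘ s =ᵐ[μ] id := hμ.ae_mem.mono fun t ht => (hsT t ht).2
    rw [Measure.map_congr this, Measure.map_id]
  have hTle : ∀ x y, edist (T x) (T y) ≤ edist x y := fun x y => by simpa using hT x y
  have hprodK : ∀ᵐ z ∂(ν.prod ν), z.1 ∈ K ∧ z.2 ∈ K :=
    (Measure.quasiMeasurePreserving_fst.ae hν.ae_mem).and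
      (Measure.quasiMeasurePreserving_snd.ae hν.ae_mem)
  -- Integrated against `ν.prod ν`, the kernels at `|T x - T y|` and at `|x - y|` give the energies
  -- of `μ` and `ν`. These are equal and finite, so the pointwise inequality is an equality almost
  -- everywhere, and `k` is injective up to `R`.
  have hisom_ae : ∀ᵐ z ∂(ν.prod ν), z ∈ {z : ℝ × ℝ | edist (T z.1) (T z.2) = edist z.1 z.2} := by
    have hTmeas : Measurable fun z : ℝ × ℝ => k (edist (T z.1) (T z.2)) :=
      hk.continuous.measurable.comp
        ((hTm.comp measurable_fst).edist (hTm.comp measurable_snd))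
    have hle : ∫⁻ z, k (edist (T z.1) (T z.2)) ∂(ν.prod ν)
        ≤ ∫⁻ z, k (edist z.1 z.2) ∂(ν.prod ν) := by
      rw [← kernelEnergyOf_eq_lintegral_prod hk.continuous, lintegral_prod _ hTmeas.aemeasurable,
        hνmin, heq, ← hμmin, ← kernelEnergyOf_map hk.continuous ν hTm, hmapT]
    have hae := ae_eq_of_ae_le_of_lintegral_le
      (ae_of_all (ν.prod ν) fun z : ℝ × ℝ => hk.antitone (hTle z.1 z.2))
      (by rwa [← kernelEnergyOf_eq_lintegral_prod hk.continuous, hνmin]) hTmeas.aemeasurable hle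
    filter_upwards [hae, hprodK] with z hz hzK
    have hzR := hR _ hzK.1 _ hzK.2
    exact hk.strictAntiOn.injOn ((hTle _ _).trans hzR) hzR hz.symm
  have hclosed : IsClosed {z : ℝ × ℝ | edist (T z.1) (T z.2) = edist z.1 z.2} := by
    have := hT.continuous
    exact isClosed_eq (by fun_prop) (by fun_prop)
  have hSK : ν.support ⊆ K := Measure.support_subset_of_isClosed hK.isClosed hν.ae_mem
  have hScomp : IsCompact ν.support := hK.of_isClosed_subset Measure.isClosed_support hSK
  have hSne : ν.support.Nonempty := Measure.nonempty_support (IsProbabilityMeasure.ne_zero ν)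
  have haS := hScomp.sInf_mem hSne
  have hbS := hScomp.sSup_mem hSne
  set a := sInf ν.support
  set b := sSup ν.support
  have hSab : ∀ y ∈ ν.support, a ≤ y ∧ y ≤ b := fun y hy =>
    ⟨csInf_le hScomp.bddBelow hy, le_csSup hScomp.bddAbove hy⟩
  have hab : a ≤ b := (hSab a haS).2
  have hisom : T b - T a = b - a := by
    have h := mem_of_ae_of_mem_support hclosed hisom_ae hbS haS
    have h0 : 0 ≤ T b - T a := by rw [hdiff a b hab]; exact measureReal_nonneg
    simp only [mem_ofPred_eq, edist_dist, Real.dist_eq] at h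
    rwa [abs_of_nonneg h0, abs_of_nonneg (sub_nonneg.2 hab),
      ENNReal.ofReal_eq_ofReal_iff h0 (sub_nonneg.2 hab)] at h
  refine ⟨a, b, hab, Icc_subset_of_volume_real_inter_Ioc hK (hSK haS)
    (by rw [← hisom, hdiff a b hab]), fun σ hσ hσfin => ?_⟩
  refine measure_mono_null ?_
    (measure_kernelPotential_lt_eq_zero hk.continuous hν hνmin hfin hσ hσfin)
  rintro z ⟨hzK, hz⟩
  have hνS : ∀ᵐ y ∂ν, y ∈ ν.support := Measure.support_mem_ae
  -- To be applied with `x` the endpoint of `[a, b]` nearer to `z`.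
  have hstep : ∀ x ∈ ν.support, (∀ y ∈ ν.support, edist x y < edist z y) →
      kernelPotential k ν z < kernelEnergy k K := by
    intro x hx hlt
    have hxle := kernelPotential_le_of_mem_support hk.continuous hν hνmin hfin hx
    exact (hk.kernelPotential_lt (IsProbabilityMeasure.ne_zero ν)
      (hνS.mono fun y hy => ⟨hlt y hy, hR z hzK y (hSK hy)⟩)
      (ne_top_of_le_ne_top hfin hxle)).trans_le hxle
  rw [mem_Icc, not_and_or, not_le, not_le] at hz
  rcases hz with hz | hz
  · refine hstep a haS fun y hy => ?_
    have := (hSab y hy).1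
    rw [edist_dist, edist_dist, Real.dist_eq, Real.dist_eq, abs_sub_comm, abs_sub_comm z,
      abs_of_nonneg (by linarith), abs_of_nonneg (by linarith)]
    exact (ENNReal.ofReal_lt_ofReal_iff (by linarith)).2 (by linarith)
  · refine hstep b hbS fun y hy => ?_
    have := (hSab y hy).2
    rw [edist_dist, edist_dist, Real.dist_eq, Real.dist_eq,
      abs_of_nonneg (by linarith), abs_of_nonneg (by linarith)]
    exact (ENNReal.ofReal_lt_ofReal_iff (by linarith)).2 (by linarith)

end

/-! ### Intervals have finite energy -/

lemma setLIntegral_enorm_rpow_ne_top {s : ℝ} (hs : s < 1) {L : ℝ} (hL : 0 ≤ L) :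
    ∫⁻ u in Icc (-L) L, ‖u‖ₑ ^ (-s) ≠ ∞ := by
  have hmeas : Measurable fun u : ℝ => ‖u‖ₑ ^ (-s) := by fun_prop
  have hpos : ∫⁻ u in Icc 0 L, ‖u‖ₑ ^ (-s) ≠ ∞ := by
    have hint := (intervalIntegral.intervalIntegrable_rpow' (a := 0) (b := L)
      (r := -s) (by linarith)).1.hasFiniteIntegral
    rw [setLIntegral_congr Ioc_ae_eq_Icc.symm]
    refine ne_of_eq_of_ne (setLIntegral_congr_fun measurableSet_Ioc fun u hu => ?_) hint.ne
    have h0 := hu.1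
    rw [Real.enorm_of_nonneg h0.le, Real.enorm_of_nonneg (Real.rpow_nonneg h0.le _),
      ENNReal.ofReal_rpow_of_pos h0]
  have hneg : ∫⁻ u in Icc (-L) 0, ‖u‖ₑ ^ (-s) = ∫⁻ u in Icc 0 L, ‖u‖ₑ ^ (-s) := by
    rw [← (Measure.measurePreserving_neg volume).setLIntegral_comp_preimage measurableSet_Icc hmeas]
    simp
  rw [← Icc_union_Icc_eq_Icc (neg_nonpos.2 hL) hL]
  refine ne_top_of_le_ne_top ?_ (lintegral_union_le _ _ _)
  rw [hneg]
  exact ENNReal.add_ne_top.2 ⟨hpos, hpos⟩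

section

variable {k : ℝ≥0∞ → ℝ≥0∞} {R : ℝ≥0∞}

/-- Normalised Lebesgue measure has a bounded potential, because the singularity of the kernel is
integrable. -/
lemma IsEnergyKernel.kernelEnergy_Icc_ne_top (hk : IsEnergyKernel k R) {L : ℝ} (hL : 0 < L) :
    kernelEnergy k (Icc 0 L) ≠ ∞ := by
  obtain ⟨s, hs0, hs1, C, hC, hle⟩ := hk.exists_le_rpow
  have hB := setLIntegral_enorm_rpow_ne_top hs1 hL.le
  set B := ∫⁻ u in Icc (-L) L, ‖u‖ₑ ^ (-s)
  have hvol : volume (Icc 0 L) ≠ 0 := by simp [hL]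
  have hvolfin : volume (Icc 0 L) ≠ ∞ := measure_Icc_lt_top.ne
  have hpot : ∀ x ∈ Icc 0 L, ∫⁻ y in Icc 0 L, k (edist x y) ≤ C * B := by
    intro x hx
    have hg : Measurable ((Icc (-L) L).indicator fun u : ℝ => ‖u‖ₑ ^ (-s)) :=
      Measurable.indicator (by fun_prop) measurableSet_Icc
    calc ∫⁻ y in Icc 0 L, k (edist x y)
        ≤ ∫⁻ y in Icc 0 L, C * (Icc (-L) L).indicator (fun u : ℝ => ‖u‖ₑ ^ (-s)) (x - y) := by
          refine setLIntegral_mono (by fun_prop) fun y hy => ?_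
          rw [indicator_of_mem (by constructor <;> linarith [hx.1, hx.2, hy.1, hy.2]),
            ← edist_eq_enorm_sub]
          exact hle _
      _ ≤ ∫⁻ y, C * (Icc (-L) L).indicator (fun u : ℝ => ‖u‖ₑ ^ (-s)) (x - y) :=
          setLIntegral_le_lintegral _ _
      _ = C * B := by
          rw [lintegral_const_mul' _ _ hC,
            lintegral_sub_left_eq_self ((Icc (-L) L).indicator fun u : ℝ => ‖u‖ₑ ^ (-s)) x,
            lintegral_indicator measurableSet_Icc]
  have hfin : kernelEnergyOf k (volume.restrict (Icc 0 L)) ≠ ∞ := by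
    refine ne_top_of_le_ne_top (b := ∫⁻ _ in Icc 0 L, C * B) ?_
      (setLIntegral_mono measurable_const hpot)
    rw [setLIntegral_const]
    exact ENNReal.mul_ne_top (ENNReal.mul_ne_top hC hB) hvolfin
  have hne : (volume.restrict (Icc 0 L)) (Icc 0 L) ≠ 0 := by rwa [Measure.restrict_apply_self]
  have hprob : IsProbOn (Icc 0 L)
      (ProbabilityTheory.cond (volume.restrict (Icc 0 L)) (Icc 0 L)) :=
    ⟨ProbabilityTheory.cond_isProbabilityMeasure hne,
      ProbabilityTheory.cond_absolutelyContinuous (by simp)⟩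
  exact ne_top_of_le_ne_top (kernelEnergyOf_cond_ne_top hne hfin) (kernelEnergy_le hprob)

lemma kernelEnergyOf_dirac (hk : Continuous k) (x : ℝ) :
    kernelEnergyOf k (Measure.dirac x) = k 0 := by
  rw [kernelEnergyOf_eq_lintegral_potential,
    lintegral_dirac' _ (measurable_kernelPotential hk _), kernelPotential,
    lintegral_dirac' _ (measurable_kernel_left hk _), edist_self]

lemma kernelEnergy_le_apply_zero (hk : Continuous k) {K : Set ℝ} (hne : K.Nonempty) :
    kernelEnergy k K ≤ k 0 := by
  obtain ⟨x, hx⟩ := hne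
  exact (kernelEnergy_le (isProbOn_dirac hx)).trans_eq (kernelEnergyOf_dirac hk x)

end

/-! ### The Riesz and logarithmic kernels -/

lemma isEnergyKernel_rpow_neg {p : ℝ} (hp0 : 0 < p) (hp1 : p < 1) (R : ℝ≥0∞) :
    IsEnergyKernel (fun r => r ^ (-p)) R := by
  have h : StrictAnti fun r : ℝ≥0∞ => r ^ (-p) := fun r r' hr => by
    simp only [ENNReal.rpow_neg]
    exact ENNReal.inv_lt_inv.2 (ENNReal.rpow_lt_rpow hr hp0)
  exact ⟨ENNReal.continuous_rpow_const, h.antitone, h.strictAntiOn _,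
    p, hp0.le, hp1, 1, by simp, fun r => by simp⟩

/-- For `p = -q < 0` the energy is maximised; subtracting from the constant `D ^ q` turns this into
minimisation of a nonnegative kernel. Truncated subtraction limits strictness to `[0, D]`. -/
lemma isEnergyKernel_sub_rpow {q : ℝ} (hq : 0 < q) {D : ℝ≥0∞} (hD : D ≠ ∞) :
    IsEnergyKernel (fun r => D ^ q - r ^ q) D := by
  have hDq : D ^ q ≠ ∞ := ENNReal.rpow_ne_top_of_nonneg hq.le hD
  refine ⟨(ENNReal.continuous_sub_left hDq).comp ENNReal.continuous_rpow_const,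
    fun r r' hr => tsub_le_tsub_left (ENNReal.rpow_le_rpow hr hq.le) _, fun r _ r' hr' hlt => ?_,
    0, le_rfl, zero_lt_one, D ^ q, hDq, fun r => by simp⟩
  have h1 : r' ^ q ≤ D ^ q := ENNReal.rpow_le_rpow hr' hq.le
  have h2 : r ^ q < r' ^ q := ENNReal.rpow_lt_rpow hlt hq
  refine (ENNReal.sub_lt_iff_lt_right (ne_top_of_le_ne_top hDq h1) h1).2 ?_
  calc D ^ q = D ^ q - r ^ q + r ^ q := (tsub_add_cancel_of_le (h2.le.trans h1)).symm
    _ < D ^ q - r ^ q + r' ^ q := ENNReal.add_lt_add_left (by finiteness) h2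

lemma isEnergyKernel_log {D : ℝ≥0∞} (hD0 : D ≠ 0) (hD : D ≠ ∞) :
    IsEnergyKernel (fun r => (ENNReal.log (D * r⁻¹)).toENNReal) D := by
  have hanti : StrictAnti fun r : ℝ≥0∞ => ENNReal.log (D * r⁻¹) := fun r r' hr =>
    ENNReal.log_strictMono (ENNReal.mul_lt_mul_right hD0 hD (ENNReal.inv_lt_inv.2 hr))
  refine ⟨?_, fun r r' hr => EReal.toENNReal_le_toENNReal (hanti.antitone hr),
    fun r _ r' hr' hlt => EReal.toENNReal_lt_toENNReal ?_ (hanti hlt), 1 / 2, by norm_num,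
    by norm_num, 2 * D ^ (1 / 2 : ℝ), ?_, fun r => ?_⟩
  · exact EReal.continuous_toENNReal.comp (ENNReal.continuous_log.comp
      ((ENNReal.continuous_const_mul hD).comp continuous_inv))
  · rw [ENNReal.zero_le_log_iff, ← ENNReal.mul_inv_cancel hD0 hD]
    exact mul_le_mul_right (ENNReal.inv_le_inv.2 hr') D
  · exact ENNReal.mul_ne_top (by simp) (ENNReal.rpow_ne_top_of_nonneg (by norm_num) hD)
  -- The bound is `log t ≤ 2 * √t` at `t = D / r`.
  · have hr : D ^ (1 / 2 : ℝ) * r ^ (-(1 / 2) : ℝ) = (D * r⁻¹) ^ (1 / 2 : ℝ) := by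
      rw [ENNReal.mul_rpow_of_nonneg _ _ (by norm_num), ENNReal.inv_rpow, ENNReal.rpow_neg]
    rw [mul_assoc, hr]
    generalize D * r⁻¹ = t
    induction t with
    | top => simp
    | coe t =>
      rcases eq_or_ne t 0 with rfl | ht
      · simp
      have ht' : (0 : ℝ) < t := by positivity
      rw [show (t : ℝ≥0∞) = ENNReal.ofReal t by simp, ENNReal.log_ofReal_of_pos ht',
        EReal.real_coe_toENNReal, ENNReal.ofReal_rpow_of_pos ht',
        show (2 : ℝ≥0∞) = ENNReal.ofReal 2 by simp, ← ENNReal.ofReal_mul (by norm_num)]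
      refine ENNReal.ofReal_le_ofReal ?_
      have := Real.log_le_rpow_div ht'.le (show (0 : ℝ) < 1 / 2 by norm_num)
      linarith

/-! ### Capacities in terms of nonnegative kernels -/

lemma rieszCap_of_pos {p : ℝ} (hp : 0 < p) (K : Set ℝ) :
    rieszCap p K = kernelEnergy (fun r => r ^ (-p)) K ^ (-1 / p) := by
  rw [rieszCap, if_neg hp.ne', rieszEnergy, if_pos hp]
  rfl

lemma rieszEnergyOf_add_kernelEnergyOf {q : ℝ} (hq : 0 < q) {D : ℝ≥0∞}
    {K : Set ℝ} (hK : ∀ x ∈ K, ∀ y ∈ K, edist x y ≤ D) {μ : Measure ℝ} (hμ : IsProbOn K μ) :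
    rieszEnergyOf (-q) μ + kernelEnergyOf (fun r => D ^ q - r ^ q) μ = D ^ q := by
  have := hμ.1
  have hc : Continuous fun r : ℝ≥0∞ => r ^ q := ENNReal.continuous_rpow_const
  have h1 : rieszEnergyOf (-q) μ = kernelEnergyOf (fun r => r ^ q) μ := by
    simp [rieszEnergyOf, kernelEnergyOf]
  rw [h1, kernelEnergyOf_eq_lintegral_potential, kernelEnergyOf_eq_lintegral_potential,
    ← lintegral_add_left (measurable_kernelPotential hc μ)]
  have h2 : ∀ᵐ x ∂μ, kernelPotential (fun r => r ^ q) μ x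
      + kernelPotential (fun r => D ^ q - r ^ q) μ x = D ^ q := by
    filter_upwards [hμ.ae_mem] with x hx
    rw [kernelPotential, kernelPotential, ← lintegral_add_left (measurable_kernel_left hc x)]
    have h3 : ∀ᵐ y ∂μ, edist x y ^ q + (D ^ q - edist x y ^ q) = D ^ q := by
      filter_upwards [hμ.ae_mem] with y hy
      exact add_tsub_cancel_of_le (ENNReal.rpow_le_rpow (hK x hx y hy) hq.le)
    rw [lintegral_congr_ae h3]
    simp
  rw [lintegral_congr_ae h2]
  simp

/-- For each measure the two energies add up to `D ^ (-p)`, so the supremum of one is complementary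
to the infimum of the other. For `K = ∅`, truncated subtraction of `∞` gives the conventional `0`.
-/
lemma rieszCap_of_neg {p : ℝ} (hp : p < 0) {D : ℝ≥0∞} (hD : D ≠ ∞)
    {K : Set ℝ} (hK : ∀ x ∈ K, ∀ y ∈ K, edist x y ≤ D) :
    rieszCap p K = (D ^ (-p) - kernelEnergy (fun r => D ^ (-p) - r ^ (-p)) K) ^ (-1 / p) := by
  rw [rieszCap, if_neg hp.ne, rieszEnergy, if_neg hp.not_gt]
  have hq : 0 < -p := by linarith
  have hDq : D ^ (-p) ≠ ∞ := ENNReal.rpow_ne_top_of_nonneg hq.le hD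
  have hadd : ∀ μ, IsProbOn K μ →
      rieszEnergyOf p μ + kernelEnergyOf (fun r => D ^ (-p) - r ^ (-p)) μ = D ^ (-p) := by
    intro μ hμ
    simpa using rieszEnergyOf_add_kernelEnergyOf hq hK hμ
  congr 1
  refine le_antisymm (iSup₂_le fun μ hμ => ?_) ?_
  · have h := hadd μ hμ
    rw [ENNReal.eq_sub_of_add_eq (ne_top_of_le_ne_top hDq (le_add_self.trans_eq h)) h]
    exact tsub_le_tsub_left (kernelEnergy_le hμ) _
  · rw [tsub_le_iff_left, ← tsub_le_iff_right]
    refine le_iInf₂ fun μ hμ => ?_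
    rw [tsub_le_iff_left]
    refine (hadd μ hμ).ge.trans ?_
    gcongr
    exact le_iSup₂_of_le μ hμ le_rfl

/-- This is `log (D / r) = log D - log r` with negative terms moved across, so that it can be
integrated in `[0, ∞]`; at `r = 0` both sides are `∞`. -/
lemma log_kernel_identity {D : ℝ≥0∞} (hD1 : 1 ≤ D) (hD : D ≠ ∞) {r : ℝ≥0∞} (hr : r ≤ D) :
    (ENNReal.log (D * r⁻¹)).toENNReal + (ENNReal.log r).toENNReal
      = (-ENNReal.log r).toENNReal + (ENNReal.log D).toENNReal := by
  lift D to NNReal using hD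
  lift r to NNReal using ne_top_of_le_ne_top ENNReal.coe_ne_top hr
  have hD0 : (0 : ℝ) < D := zero_lt_one.trans_le (by exact_mod_cast hD1)
  rcases eq_or_ne r 0 with rfl | hr0
  · have : D ≠ 0 := fun h => by simp [h] at hD0
    simp [ENNReal.mul_top, this]
  have hr0' : (0 : ℝ) < r := by positivity
  have hrD : (r : ℝ) ≤ D := by exact_mod_cast hr
  have hlog : Real.log r ≤ Real.log D := Real.log_le_log hr0' hrD
  have hlogD : 0 ≤ Real.log D := Real.log_nonneg (by exact_mod_cast hD1)
  rw [ENNReal.log_mul_add, ENNReal.log_inv, show (D : ℝ≥0∞) = ENNReal.ofReal D by simp,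
    show (r : ℝ≥0∞) = ENNReal.ofReal r by simp, ENNReal.log_ofReal_of_pos hD0,
    ENNReal.log_ofReal_of_pos hr0', ← EReal.coe_neg, ← EReal.coe_add,
    EReal.real_coe_toENNReal, EReal.real_coe_toENNReal, EReal.real_coe_toENNReal,
    EReal.real_coe_toENNReal]
  rcases le_total 0 (Real.log r) with h | h
  · rw [← ENNReal.ofReal_add (by linarith) h, ENNReal.ofReal_of_nonpos (by linarith : -Real.log r ≤ 0)]
    simp
  · rw [ENNReal.ofReal_of_nonpos h, ← ENNReal.ofReal_add (by linarith) hlogD, add_zero, add_comm]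

lemma coe_sub_coe_of_add_eq_add {a b c d : ℝ≥0∞} (hb : b ≠ ∞) (hc : c ≠ ∞) (h : a + b = d + c) :
    (d : EReal) - b = a - c := by
  lift b to NNReal using hb
  lift c to NNReal using hc
  induction a with
  | top =>
    have : d = ⊤ := by
      by_contra hd
      lift d to NNReal using hd
      rw [top_add, ← ENNReal.coe_add] at h
      exact ENNReal.coe_ne_top h.symm
    subst this
    rfl
  | coe a =>
    have hd : d ≠ ⊤ := by
      rintro rfl
      rw [top_add, ← ENNReal.coe_add] at h
      exact ENNReal.coe_ne_top h
    lift d to NNReal using hd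
    have h' : (a : ℝ) + b = d + c := by exact_mod_cast h
    change ((d : ℝ) : EReal) - ((b : ℝ) : EReal) = ((a : ℝ) : EReal) - ((c : ℝ) : EReal)
    rw [← EReal.coe_sub, ← EReal.coe_sub]
    congr 1
    linarith

lemma logEnergyOf_eq {D : ℝ≥0∞} (hD1 : 1 ≤ D) (hD : D ≠ ∞)
    {K : Set ℝ} (hK : ∀ x ∈ K, ∀ y ∈ K, edist x y ≤ D) {μ : Measure ℝ} (hμ : IsProbOn K μ) :
    logEnergyOf μ = kernelEnergyOf (fun r => (ENNReal.log (D * r⁻¹)).toENNReal) μ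
      - ENNReal.log D := by
  have := hμ.1
  have hlogD0 : 0 ≤ ENNReal.log D := by simpa using hD1
  have hlogD : (ENNReal.log D).toENNReal ≠ ∞ := by simpa [EReal.toENNReal_eq_top_iff] using hD
  have hD0 : D ≠ 0 := (zero_lt_one.trans_le hD1).ne'
  have hc := (isEnergyKernel_log hD0 hD).continuous
  have hcp : Continuous fun r : ℝ≥0∞ => (ENNReal.log r).toENNReal :=
    EReal.continuous_toENNReal.comp ENNReal.continuous_log
  have hcn : Continuous fun r : ℝ≥0∞ => (-ENNReal.log r).toENNReal :=
    EReal.continuous_toENNReal.comp (continuous_neg.comp ENNReal.continuous_log)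
  rw [← EReal.coe_toENNReal hlogD0]
  refine coe_sub_coe_of_add_eq_add ?_ hlogD ?_
  · refine ne_top_of_le_ne_top hlogD ?_
    calc ∫⁻ x, ∫⁻ y, (ENNReal.log (edist x y)).toENNReal ∂μ ∂μ
        ≤ ∫⁻ _, ∫⁻ _, (ENNReal.log D).toENNReal ∂μ ∂μ := by
          refine lintegral_mono_ae (hμ.ae_mem.mono fun x hx => ?_)
          refine lintegral_mono_ae (hμ.ae_mem.mono fun y hy => ?_)
          exact EReal.toENNReal_le_toENNReal (ENNReal.log_monotone (hK x hx y hy))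
      _ = (ENNReal.log D).toENNReal := by simp
  · change kernelEnergyOf _ μ + kernelEnergyOf (fun r => (ENNReal.log r).toENNReal) μ
      = kernelEnergyOf (fun r => (-ENNReal.log r).toENNReal) μ + _
    rw [kernelEnergyOf_eq_lintegral_potential, kernelEnergyOf_eq_lintegral_potential,
      kernelEnergyOf_eq_lintegral_potential, ← lintegral_add_left (measurable_kernelPotential hc μ)]
    have hconst : (ENNReal.log D).toENNReal = ∫⁻ _, (ENNReal.log D).toENNReal ∂μ := by simp
    rw [hconst]
    rw [← lintegral_add_left (measurable_kernelPotential hcn μ)]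
    refine lintegral_congr_ae (hμ.ae_mem.mono fun x hx => ?_)
    simp only [kernelPotential]
    rw [hconst]
    rw [← lintegral_add_left (measurable_kernel_left hc x),
      ← lintegral_add_left (measurable_kernel_left hcn x)]
    exact lintegral_congr_ae (hμ.ae_mem.mono fun y hy => log_kernel_identity hD1 hD (hK x hx y hy))

lemma rieszCap_zero {D : ℝ≥0∞} (hD1 : 1 ≤ D) (hD : D ≠ ∞)
    {K : Set ℝ} (hK : ∀ x ∈ K, ∀ y ∈ K, edist x y ≤ D) :
    rieszCap 0 K
      = D * EReal.exp (-kernelEnergy (fun r => (ENNReal.log (D * r⁻¹)).toENNReal) K) := by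
  have hD0 : D ≠ 0 := (zero_lt_one.trans_le hD1).ne'
  have hbot : ENNReal.log D ≠ ⊥ := by simpa using hD0
  have htop : ENNReal.log D ≠ ⊤ := by simpa using hD
  set k : ℝ≥0∞ → ℝ≥0∞ := fun r => (ENNReal.log (D * r⁻¹)).toENNReal
  have hlog : logEnergy K = kernelEnergy k K - ENNReal.log D := by
    refine le_antisymm ?_ (le_iInf₂ fun μ hμ => ?_)
    · rw [EReal.le_sub_iff_add_le (Or.inl hbot) (Or.inl htop)]
      -- `kernelEnergy` is an infimum in `ℝ≥0∞` and `logEnergy` one in `EReal`; the lower bound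
      -- passes between them through `toENNReal`.
      have h : (logEnergy K + ENNReal.log D).toENNReal ≤ kernelEnergy k K := by
        refine le_iInf₂ fun μ hμ => ?_
        rw [← EReal.toENNReal_coe (x := kernelEnergyOf k μ)]
        refine EReal.toENNReal_le_toENNReal ?_
        rw [← EReal.le_sub_iff_add_le (Or.inl hbot) (Or.inl htop), ← logEnergyOf_eq hD1 hD hK hμ]
        exact iInf₂_le μ hμ
      calc logEnergy K + ENNReal.log D
          ≤ ((logEnergy K + ENNReal.log D).toENNReal : EReal) := by
            rw [EReal.coe_toENNReal_eq_max]; exact le_max_right _ _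
        _ ≤ kernelEnergy k K := by exact_mod_cast h
    · rw [logEnergyOf_eq hD1 hD hK hμ]
      exact EReal.sub_le_sub (by exact_mod_cast kernelEnergy_le hμ) le_rfl
  rw [rieszCap, if_pos rfl, hlog, EReal.neg_sub (Or.inr hbot) (Or.inr htop), EReal.exp_add,
    ENNReal.exp_log, mul_comm]

/-- On compact sets of bounded diameter, the capacity is a strictly decreasing function of the
energy for a suitable nonnegative kernel. -/
theorem exists_energyKernel_rieszCap {p : ℝ} (hp : p < 1) {D : ℝ≥0∞} (hD1 : 1 ≤ D) (hD : D ≠ ∞) :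
    ∃ k Φ : ℝ≥0∞ → ℝ≥0∞, IsEnergyKernel k D ∧ StrictAntiOn Φ (Iic (k 0)) ∧
      (0 ≤ p → k 0 = ∞ ∧ Φ ∞ = 0) ∧ (p < 0 → k 0 ≠ ∞) ∧
      ∀ K : Set ℝ, (∀ x ∈ K, ∀ y ∈ K, edist x y ≤ D) → rieszCap p K = Φ (kernelEnergy k K) := by
  rcases lt_trichotomy p 0 with h | rfl | h
  · have hq : 0 < -p := by linarith
    have hDq : D ^ (-p) ≠ ∞ := ENNReal.rpow_ne_top_of_nonneg hq.le hD
    -- This function vanishes from `k 0 = D ^ (-p)` on, whence strictness only up to `k 0`.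
    refine ⟨_, fun V => (D ^ (-p) - V) ^ (-1 / p), isEnergyKernel_sub_rpow hq hD, ?_,
      fun h0 => absurd h h0.not_gt, fun _ => by finiteness, fun K hK => rieszCap_of_neg h hD hK⟩
    intro V _ W hW hVW
    have hW' : W ≤ D ^ (-p) := by simpa [ENNReal.zero_rpow_of_pos hq] using hW
    refine ENNReal.rpow_lt_rpow ?_ (div_pos_of_neg_of_neg (by norm_num) h)
    refine (ENNReal.sub_lt_iff_lt_right (ne_top_of_le_ne_top hDq hW') hW').2 ?_
    calc D ^ (-p) = D ^ (-p) - V + V := (tsub_add_cancel_of_le (hVW.le.trans hW')).symm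
      _ < D ^ (-p) - V + W := ENNReal.add_lt_add_left (by finiteness) hVW
  · have hD0 : D ≠ 0 := (zero_lt_one.trans_le hD1).ne'
    refine ⟨_, fun V => D * EReal.exp (-V), isEnergyKernel_log hD0 hD, ?_, fun _ => ⟨?_, ?_⟩,
      fun h => absurd h (lt_irrefl _), fun K hK => rieszCap_zero hD1 hD hK⟩
    · intro V _ W _ hVW
      refine ENNReal.mul_lt_mul_right hD0 hD (EReal.exp_strictMono (EReal.neg_lt_neg_iff.2 ?_))
      exact_mod_cast hVW
    · simp [ENNReal.mul_top hD0]
    · simp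
  · refine ⟨_, fun V => V ^ (-1 / p), isEnergyKernel_rpow_neg h hp D, ?_, fun _ => ⟨?_, ?_⟩,
      fun h' => absurd h h'.not_gt, fun K _ => rieszCap_of_pos h K⟩
    · intro V _ W _ hVW
      simp only [neg_div, ENNReal.rpow_neg]
      exact ENNReal.inv_lt_inv.2 (ENNReal.rpow_lt_rpow hVW (by positivity))
    · simp [h]
    · have : -1 / p < 0 := div_neg_of_neg_of_pos (by norm_num) h
      simp [this]

/-! ### Scaling -/

lemma edist_affine {c : ℝ} (hc : 0 < c) (d x y : ℝ) :
    edist (c * x + d) (c * y + d) = ENNReal.ofReal c * edist x y := by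
  rw [edist_dist, edist_dist, ← ENNReal.ofReal_mul hc.le, Real.dist_eq, Real.dist_eq,
    show c * x + d - (c * y + d) = c * (x - y) by ring, abs_mul, abs_of_pos hc]

lemma mul_rpow_of_ne_zero_of_ne_top {c : ℝ≥0∞} (hc0 : c ≠ 0) (hc : c ≠ ∞) (r : ℝ≥0∞) (z : ℝ) :
    (c * r) ^ z = c ^ z * r ^ z := by
  simp [ENNReal.mul_rpow_eq_ite, hc0, hc]

lemma rieszEnergyOf_map_affine {p c : ℝ} (hc : 0 < c) (d : ℝ) (μ : Measure ℝ) [SFinite μ] :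
    rieszEnergyOf p (μ.map fun x => c * x + d) = ENNReal.ofReal c ^ (-p) * rieszEnergyOf p μ := by
  have hc0 : ENNReal.ofReal c ≠ 0 := by simpa using hc
  have hcp : ENNReal.ofReal c ^ (-p) ≠ ∞ := by
    rw [ENNReal.ofReal_rpow_of_pos hc]; exact ENNReal.ofReal_ne_top
  change kernelEnergyOf (fun r => r ^ (-p)) (μ.map fun x => c * x + d) = _
  rw [kernelEnergyOf_map ENNReal.continuous_rpow_const μ (by fun_prop), rieszEnergyOf,
    ← lintegral_const_mul' _ _ hcp]
  refine lintegral_congr fun x => ?_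
  rw [← lintegral_const_mul' _ _ hcp]
  refine lintegral_congr fun y => ?_
  rw [edist_affine hc, mul_rpow_of_ne_zero_of_ne_top hc0 ENNReal.ofReal_ne_top]

lemma mul_rieszCap_le_of_affine (p : ℝ) {c : ℝ} (hc : 0 < c) (d : ℝ) {K K' : Set ℝ}
    (hK : Bornology.IsBounded K) (hK' : Bornology.IsBounded K') (hKm : MeasurableSet K')
    (hmaps : ∀ x ∈ K, c * x + d ∈ K') :
    ENNReal.ofReal c * rieszCap p K ≤ rieszCap p K' := by
  have hc0 : ENNReal.ofReal c ≠ 0 := by simpa using hc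
  have hct : ENNReal.ofReal c ≠ ∞ := ENNReal.ofReal_ne_top
  have hf : Measurable fun x : ℝ => c * x + d := by fun_prop
  have hcp : ENNReal.ofReal c ^ (-p) ≠ ∞ := by
    rw [ENNReal.ofReal_rpow_of_pos hc]; exact ENNReal.ofReal_ne_top
  have hcp0 : ENNReal.ofReal c ^ (-p) ≠ 0 := by
    rw [ENNReal.ofReal_rpow_of_pos hc]
    simpa using Real.rpow_pos_of_pos hc _
  rcases eq_or_ne p 0 with rfl | hp
  · set C := ENNReal.ofReal c
    -- Chosen so that `D` and `C * D` are both at least `1` and bound the diameters of `K` and `K'`.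
    -- With these two constants the logarithmic kernels correspond exactly under the scaling.
    set D : ℝ≥0∞ := 1 + C⁻¹ + Metric.ediam K + C⁻¹ * Metric.ediam K' with hD
    have hCi : C⁻¹ ≠ ∞ := ENNReal.inv_ne_top.2 hc0
    have hd := hK.ediam_ne_top
    have hd' := hK'.ediam_ne_top
    have hDt : D ≠ ∞ := by finiteness
    have hD1 : 1 ≤ D := le_add_right (le_add_right le_self_add)
    have hCD : C * D = C + 1 + C * Metric.ediam K + Metric.ediam K' := by
      rw [hD, mul_add, mul_add, mul_add, mul_one, ← mul_assoc, ENNReal.mul_inv_cancel hc0 hct,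
        one_mul]
    have hCD1 : 1 ≤ C * D := by
      rw [hCD]; exact le_add_right (le_add_right le_add_self)
    have hKD : ∀ x ∈ K, ∀ y ∈ K, edist x y ≤ D := fun x hx y hy =>
      (Metric.edist_le_ediam_of_mem hx hy).trans (le_add_right le_add_self)
    have hKD' : ∀ x ∈ K', ∀ y ∈ K', edist x y ≤ C * D := fun x hx y hy => by
      rw [hCD]; exact (Metric.edist_le_ediam_of_mem hx hy).trans le_add_self
    rw [rieszCap_zero hD1 hDt hKD, rieszCap_zero hCD1 (by finiteness) hKD', ← mul_assoc]
    gcongr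
    refine EReal.neg_le_neg_iff.2 ?_
    norm_cast
    refine le_iInf₂ fun μ hμ => ?_
    have := hμ.1
    refine (kernelEnergy_le (hμ.map hf hKm hmaps)).trans_eq ?_
    rw [kernelEnergyOf_map (isEnergyKernel_log (by positivity) (by finiteness)).continuous μ hf]
    refine lintegral_congr fun x => lintegral_congr fun y => ?_
    rw [edist_affine hc, ENNReal.mul_inv (Or.inl hc0) (Or.inl hct), mul_mul_mul_comm,
      ENNReal.mul_inv_cancel hc0 hct, one_mul]
  · have hcE : ∀ E : ℝ≥0∞,
        ENNReal.ofReal c * E ^ (-1 / p) = (ENNReal.ofReal c ^ (-p) * E) ^ (-1 / p) := by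
      intro E
      rw [mul_rpow_of_ne_zero_of_ne_top hcp0 hcp, ← ENNReal.rpow_mul,
        show -p * (-1 / p) = 1 by field_simp, ENNReal.rpow_one]
    rw [rieszCap, rieszCap, if_neg hp, if_neg hp, hcE]
    rcases hp.lt_or_gt with h | h
    · refine ENNReal.rpow_le_rpow ?_ (div_pos_of_neg_of_neg (by norm_num) h).le
      simp only [rieszEnergy, if_neg h.not_gt, ENNReal.mul_iSup]
      refine iSup₂_le fun μ hμ => ?_
      have := hμ.1
      rw [← rieszEnergyOf_map_affine hc d μ]
      exact le_iSup₂_of_le _ (hμ.map hf hKm hmaps) le_rfl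
    · simp only [neg_div, ENNReal.rpow_neg]
      refine ENNReal.inv_le_inv.2 (ENNReal.rpow_le_rpow ?_ (by positivity))
      simp only [← ENNReal.rpow_neg, rieszEnergy, if_pos h, ENNReal.mul_iInf_of_ne hcp0 hcp]
      refine le_iInf₂ fun μ hμ => ?_
      have := hμ.1
      rw [← rieszEnergyOf_map_affine hc d μ]
      exact iInf₂_le _ (hμ.map hf hKm hmaps)

lemma rieszCap_Icc (p : ℝ) {a b : ℝ} (hab : a < b) :
    rieszCap p (Icc a b)
      = rieszCap p (Metric.closedBall (0 : ℝ) 1) / 2 * ENNReal.ofReal (b - a) := by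
  set c : ℝ := (b - a) / 2 with hc
  have hc0 : 0 < c := by simp only [hc]; linarith
  have hcne : ENNReal.ofReal c ≠ 0 := by simpa using hc0
  have hball : Metric.closedBall (0 : ℝ) 1 = Icc (-1) 1 := by simp [Real.closedBall_eq_Icc]
  have h1 : ENNReal.ofReal c * rieszCap p (Icc (-1) 1) ≤ rieszCap p (Icc a b) := by
    refine mul_rieszCap_le_of_affine p hc0 ((a + b) / 2) (Metric.isBounded_Icc _ _)
      (Metric.isBounded_Icc _ _) measurableSet_Icc fun x hx => ?_
    constructor <;> nlinarith [hx.1, hx.2]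
  have h2 : ENNReal.ofReal c⁻¹ * rieszCap p (Icc a b) ≤ rieszCap p (Icc (-1) 1) := by
    refine mul_rieszCap_le_of_affine p (inv_pos.2 hc0) (-c⁻¹ * ((a + b) / 2)) (Metric.isBounded_Icc _ _)
      (Metric.isBounded_Icc _ _) measurableSet_Icc fun x hx => ?_
    have hx' : c⁻¹ * x + -c⁻¹ * ((a + b) / 2) = (x - (a + b) / 2) / c := by field_simp; ring
    rw [hx', mem_Icc, le_div_iff₀ hc0, div_le_iff₀ hc0]
    constructor <;> linarith [hx.1, hx.2]
  have h3 : rieszCap p (Icc a b) = ENNReal.ofReal c * rieszCap p (Icc (-1) 1) := by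
    refine le_antisymm ?_ h1
    calc rieszCap p (Icc a b)
        = ENNReal.ofReal c * (ENNReal.ofReal c⁻¹ * rieszCap p (Icc a b)) := by
          rw [← mul_assoc, ← ENNReal.ofReal_mul hc0.le, mul_inv_cancel₀ hc0.ne', ENNReal.ofReal_one,
            one_mul]
      _ ≤ _ := by gcongr
  rw [h3, hball, hc, ENNReal.ofReal_div_of_pos two_pos, ENNReal.ofReal_ofNat, div_eq_mul_inv,
    div_eq_mul_inv]
  ring

/-! ### Sets of capacity zero -/

lemma exists_diameter_bound {K : Set ℝ} (hK : IsCompact K) :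
    ∃ D : ℝ≥0∞, 1 ≤ D ∧ D ≠ ∞ ∧ (∀ x ∈ K, ∀ y ∈ K, edist x y ≤ D) ∧
      ∀ x ∈ Icc 0 (volume.real K), ∀ y ∈ Icc 0 (volume.real K), edist x y ≤ D := by
  have hd := hK.isBounded.ediam_ne_top
  refine ⟨1 + Metric.ediam K + ENNReal.ofReal (volume.real K), le_add_right le_self_add,
    by finiteness, fun x hx y hy => ?_, fun x hx y hy => ?_⟩
  · exact (Metric.edist_le_ediam_of_mem hx hy).trans (le_add_right le_add_self)
  · refine (Metric.edist_le_ediam_of_mem hx hy).trans ?_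
    rw [Real.ediam_Icc, sub_zero]
    exact le_add_self

/-- A set of positive length has at most the energy of an interval, which is finite. -/
lemma volume_eq_zero_of_rieszCap_eq_zero {p : ℝ} (hp0 : 0 ≤ p) (hp : p < 1) {K : Set ℝ}
    (hK : IsCompact K) (hcap : rieszCap p K = 0) : volume K = 0 := by
  by_contra hvol
  have hne : K.Nonempty := nonempty_of_measure_ne_zero hvol
  obtain ⟨D, hD1, hD, hKD, -⟩ := exists_diameter_bound hK
  obtain ⟨k, Φ, hk, hΦ, h0, -, hcapΦ⟩ := exists_energyKernel_rieszCap hp hD1 hD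
  obtain ⟨hk0, hΦ0⟩ := h0 hp0
  have hL : 0 < volume.real K := ENNReal.toReal_pos hvol hK.measure_lt_top.ne
  have hfin : kernelEnergy k K < ∞ :=
    (hk.kernelEnergy_le_kernelEnergy_Icc hK hne).trans_lt (hk.kernelEnergy_Icc_ne_top hL).lt_top
  have := hΦ (by simp [hk0]) (by simp [hk0]) hfin
  rw [hΦ0, ← hcapΦ K hKD, hcap] at this
  exact lt_irrefl _ this

lemma InnerCapZero.volume_eq_zero {p : ℝ} (hp0 : 0 ≤ p) (hp : p < 1) {Z A : Set ℝ}
    (hZ : InnerCapZero p Z) (hA : MeasurableSet A) (hAZ : A ⊆ Z) : volume A = 0 := by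
  by_contra h
  obtain ⟨Z', hZ'A, hZ'c, hpos⟩ := hA.exists_lt_isCompact (pos_iff_ne_zero.2 h)
  exact hpos.ne'
    (volume_eq_zero_of_rieszCap_eq_zero hp0 hp hZ'c (hZ Z' hZ'c (hZ'A.trans hAZ)))

lemma rieszCap_eq_zero_iff_of_neg {p : ℝ} (hp : p < 0) (K : Set ℝ) :
    rieszCap p K = 0 ↔ K = ∅ ∨ ∃ x : ℝ, K = {x} := by
  have hq : 0 < -p := by linarith
  have hpp : 0 < -1 / p := div_pos_of_neg_of_neg (by norm_num) hp
  rw [rieszCap, if_neg hp.ne, ENNReal.rpow_eq_zero_iff_of_pos hpp, rieszEnergy, if_neg hp.not_gt]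
  simp only [ENNReal.iSup_eq_zero]
  have hc : Continuous fun r : ℝ≥0∞ => r ^ (-p) := ENNReal.continuous_rpow_const
  constructor
  · intro h
    rw [← subsingleton_iff_eq_empty_or_singleton]
    intro x hx y hy
    by_contra hxy
    -- Equal masses at two distinct points have energy `|x - y| ^ (-p) / 2 > 0`.
    set μ : Measure ℝ := (2⁻¹ : NNReal) • Measure.dirac x + (2⁻¹ : NNReal) • Measure.dirac y
    have hprob : IsProbOn K μ := by
      refine ⟨⟨?_⟩, ?_⟩
      · simp only [μ, Measure.coe_add, Measure.coe_nnreal_smul_apply, Pi.add_apply, measure_univ,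
          mul_one]
        rw [← ENNReal.coe_add, ← ENNReal.coe_one, ENNReal.coe_inj]
        ext
        norm_num
      · simp [μ, (isProbOn_dirac hx).2, (isProbOn_dirac hy).2]
    have h0 := h μ hprob
    change kernelEnergyOf (fun r => r ^ (-p)) μ = 0 at h0
    rw [kernelEnergyOf_smul_add_smul hc, lintegral_dirac' _ (measurable_kernelPotential hc _),
      kernelPotential, lintegral_dirac' _ (measurable_kernel_left hc _)] at h0
    simp [hq.not_gt, Ne.symm hxy] at h0
  · rintro (rfl | ⟨z, rfl⟩) μ hμ
    · have := hμ.1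
      have h := hμ.2
      simp at h
    · have hae := hμ.ae_mem
      have h1 : ∀ᵐ x ∂μ, ∫⁻ y, edist x y ^ (-p) ∂μ = 0 := by
        filter_upwards [hae] with x hx
        rw [lintegral_eq_zero_iff (measurable_kernel_left hc x)]
        filter_upwards [hae] with y hy
        rw [mem_singleton_iff.1 hx, mem_singleton_iff.1 hy]
        simp [hq]
      rw [rieszEnergyOf, lintegral_congr_ae h1]
      simp

section

variable {p : ℝ} {K : Set ℝ} {k Φ : ℝ≥0∞ → ℝ≥0∞}

/-- A finite-energy probability measure on a compact subset of `Z` would have to give `Z` mass zero.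
-/
lemma innerCapZero_of_measure_eq_zero {Z : Set ℝ} (hZK : Z ⊆ K) (hΦ0 : Φ ∞ = 0)
    (hcap : ∀ K' ⊆ K, rieszCap p K' = Φ (kernelEnergy k K'))
    (hZ : ∀ σ, IsProbOn K σ → kernelEnergyOf k σ ≠ ∞ → σ Z = 0) : InnerCapZero p Z := by
  intro Z' _ hZ'Z
  have htop : kernelEnergy k Z' = ∞ := by
    simp only [kernelEnergy, iInf_eq_top]
    intro σ hσ
    by_contra hfin
    have := hσ.1
    have h0 : σ Z = 0 := hZ σ ⟨hσ.1,
      measure_mono_null (compl_subset_compl.2 (hZ'Z.trans hZK)) hσ.2⟩ hfin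
    have huniv : σ univ = 0 := by
      rw [← union_compl_self Z']
      exact measure_union_null (measure_mono_null hZ'Z h0) hσ.2
    simp at huniv
  rw [hcap Z' (hZ'Z.trans hZK), htop, hΦ0]

/-- Removing a measurable set of inner capacity zero does not change the energy. -/
lemma InnerCapZero.kernelEnergy_le_diff {Z A : Set ℝ} (hZ : InnerCapZero p Z)
    (hA : MeasurableSet A) (hAZ : A ⊆ Z) (hAK : A ⊆ K)
    (hΦ : ∀ V, V ≠ ∞ → Φ V ≠ 0)
    (hcap : ∀ K' ⊆ K, rieszCap p K' = Φ (kernelEnergy k K')) :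
    kernelEnergy k (K \ A) ≤ kernelEnergy k K := by
  refine le_iInf₂ fun σ hσ => ?_
  rcases eq_or_ne (kernelEnergyOf k σ) ∞ with htop | hfin
  · exact htop ▸ le_top
  have := hσ.1
  refine kernelEnergy_le ⟨hσ.1, ?_⟩
  rw [sdiff_eq, compl_inter, compl_compl]
  refine measure_union_null hσ.2 ?_
  -- If `σ` charged `A`, conditioning it on a compact subset would give that subset finite energy,
  -- hence positive capacity.
  by_contra h
  obtain ⟨Z', hZ'A, hZ'c, hpos⟩ := hA.exists_lt_isCompact (pos_iff_ne_zero.2 h)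
  have hprob : IsProbOn Z' (ProbabilityTheory.cond σ Z') :=
    ⟨ProbabilityTheory.cond_isProbabilityMeasure hpos.ne',
      ProbabilityTheory.ae_cond_mem hZ'c.measurableSet⟩
  have hcapZ := hZ Z' hZ'c (hZ'A.trans hAZ)
  rw [hcap Z' (hZ'A.trans hAK)] at hcapZ
  exact hΦ _ (ne_top_of_le_ne_top (kernelEnergyOf_cond_ne_top hpos.ne' hfin)
    (kernelEnergy_le hprob)) hcapZ

end

/-! ### Comparison of capacities and the equality cases -/

/-- The capacity comparison for compact sets of positive length. -/
theorem rieszCap_Icc_le_and_eq_iff {p : ℝ} (hp : p < 1) {K : Set ℝ} (hK : IsCompact K)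
    (hvol : 0 < volume K) :
    rieszCap p (Icc 0 (volume.real K)) ≤ rieszCap p K ∧
      (rieszCap p K = rieszCap p (Icc 0 (volume.real K)) ↔
        ∃ (a b : ℝ) (Z : Set ℝ), a < b ∧ K = Icc a b ∪ Z ∧
          (0 ≤ p → InnerCapZero p Z) ∧ (p < 0 → Z = ∅)) := by
  have hne : K.Nonempty := nonempty_of_measure_ne_zero hvol.ne'
  have hL : 0 < volume.real K := ENNReal.toReal_pos hvol.ne' hK.measure_lt_top.ne
  obtain ⟨D, hD1, hD, hKD, hID⟩ := exists_diameter_bound hK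
  obtain ⟨k, Φ, hk, hΦ, hnonneg, hneg, hcapΦ⟩ := exists_energyKernel_rieszCap hp hD1 hD
  have hcap : ∀ K' ⊆ K, rieszCap p K' = Φ (kernelEnergy k K') := fun K' h =>
    hcapΦ K' fun x hx y hy => hKD x (h hx) y (h hy)
  have hle := hk.kernelEnergy_le_kernelEnergy_Icc hK hne
  have hfinI := hk.kernelEnergy_Icc_ne_top hL
  have hfinK := ne_top_of_le_ne_top hfinI hle
  have hmemI := kernelEnergy_le_apply_zero hk.continuous
    (⟨0, le_rfl, hL.le⟩ : (Icc 0 (volume.real K)).Nonempty)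
  have hmemK := kernelEnergy_le_apply_zero hk.continuous hne
  rw [hcap K subset_rfl, hcapΦ _ hID]
  refine ⟨hΦ.antitoneOn hmemK hmemI hle, ?_⟩
  constructor
  · intro heq
    obtain ⟨a, b, hab, hsub, hσ⟩ := hk.exists_Icc_of_kernelEnergy_eq hK hne hKD hfinK
      (hΦ.injOn hmemK hmemI heq)
    have hinner : 0 ≤ p → InnerCapZero p (K \ Icc a b) := fun hp0 =>
      innerCapZero_of_measure_eq_zero sdiff_subset (hnonneg hp0).2 hcap hσ
    have hempty : p < 0 → K \ Icc a b = ∅ := by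
      intro hp0
      by_contra! hcon
      obtain ⟨z, hz⟩ := hcon
      have h := hσ _ (isProbOn_dirac hz.1) (by
        rw [kernelEnergyOf_dirac hk.continuous]; exact hneg hp0)
      rw [Measure.dirac_apply_of_mem hz] at h
      exact one_ne_zero h
    refine ⟨a, b, K \ Icc a b, hab.lt_of_ne ?_, (union_sdiff_cancel hsub).symm, hinner, hempty⟩
    -- A degenerate interval would leave `K` of length zero.
    rintro rfl
    have hnull : volume (K \ Icc a a) = 0 := by
      rcases lt_or_ge p 0 with hp0 | hp0
      · rw [hempty hp0, measure_empty]
      · exact (hinner hp0).volume_eq_zero hp0 hp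
          (hK.measurableSet.diff measurableSet_Icc) subset_rfl
    have : volume K = 0 := by
      rw [← union_sdiff_cancel hsub]
      exact measure_union_null (by simp) hnull
    exact hvol.ne' this
  · rintro ⟨a, b, Z, hab, hKZ, hZ, hZempty⟩
    have hsub : Icc a b ⊆ K := hKZ ▸ subset_union_left
    -- `Z` may overlap the interval and be nonmeasurable; `K \ Icc a b` replaces it.
    have hAZ : K \ Icc a b ⊆ Z := by
      rw [hKZ, union_sdiff_left]; exact sdiff_subset
    have hAm := hK.measurableSet.diff (measurableSet_Icc (a := a) (b := b))
    have hsdiff : K \ (K \ Icc a b) = Icc a b := by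
      rw [sdiff_sdiff_right_self]; exact inter_eq_right.2 hsub
    have hkey : volume (K \ Icc a b) = 0 ∧ kernelEnergy k K = kernelEnergy k (Icc a b) := by
      rcases lt_or_ge p 0 with hp0 | hp0
      · have hKI : K = Icc a b := by rw [hKZ, hZempty hp0, union_empty]
        simp [hKI]
      · obtain ⟨hk0, hΦ0⟩ := hnonneg hp0
        refine ⟨(hZ hp0).volume_eq_zero hp0 hp hAm hAZ, le_antisymm (kernelEnergy_anti hsub) ?_⟩
        have h := (hZ hp0).kernelEnergy_le_diff (k := k) hAm hAZ sdiff_subset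
          (fun V hV => (hΦ0 ▸ hΦ (by simp [hk0]) (by simp [hk0]) hV.lt_top : 0 < Φ V).ne') hcap
        rwa [hsdiff] at h
    have hvolI : volume.real K = b - a := by
      rw [measureReal_def, ← measure_sdiff_null hkey.1, hsdiff, Real.volume_Icc,
        ENNReal.toReal_ofReal (by linarith)]
    rw [hkey.2, ← hcap _ hsub, ← hcapΦ _ hID, hvolI, rieszCap_Icc p hab,
      rieszCap_Icc p (sub_pos.2 hab), sub_zero]

theorem mainTheorem7 (p : ℝ) (hp : p < 1) (K : Set ℝ) (hK : IsCompact K) :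
    rieszCap p (Metric.closedBall (0 : ℝ) 1) / 2 * volume K ≤ rieszCap p K ∧
    (0 < volume K →
      (rieszCap p K = rieszCap p (Metric.closedBall (0 : ℝ) 1) / 2 * volume K ↔
        ∃ (a b : ℝ) (Z : Set ℝ), a < b ∧ K = Icc a b ∪ Z ∧
          (0 ≤ p → InnerCapZero p Z) ∧ (p < 0 → Z = ∅))) ∧
    (volume K = 0 →
      (rieszCap p K = rieszCap p (Metric.closedBall (0 : ℝ) 1) / 2 * volume K ↔
        rieszCap p K = 0) ∧
      (p < 0 → (rieszCap p K = 0 ↔ K = ∅ ∨ ∃ x : ℝ, K = {x}))) := by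
  have hI : 0 < volume K → rieszCap p (Metric.closedBall (0 : ℝ) 1) / 2 * volume K
      = rieszCap p (Icc 0 (volume.real K)) := by
    intro hvol
    have hL : 0 < volume.real K := ENNReal.toReal_pos hvol.ne' hK.measure_lt_top.ne
    rw [rieszCap_Icc p hL, sub_zero, measureReal_def,
      ENNReal.ofReal_toReal hK.measure_lt_top.ne]
  refine ⟨?_, fun hvol => ?_, fun hvol => ⟨by rw [hvol, mul_zero], fun hp0 =>
    rieszCap_eq_zero_iff_of_neg hp0 K⟩⟩
  · rcases eq_zero_or_pos (volume K) with hvol | hvol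
    · simp [hvol]
    · rw [hI hvol]
      exact (rieszCap_Icc_le_and_eq_iff hp hK hvol).1
  · rw [hI hvol]
    exact (rieszCap_Icc_le_and_eq_iff hp hK hvol).2
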